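/- For $n\ge 0$ let $\mathfrak S_n$ be the set of permutations $\pi=a_1a_2\cdots a_n$ of $\{1,\dots,n\}$. A descent of $\pi$ is a position $i\in\{1,\dots,n-1\}$ with $a_i>a_{i+1}$; let $\mathrm{odes}(\pi)$ and $\mathrm{edes}(\pi)$ be the numbers of descents of $\pi$ in odd and in even positions, respectively. Let $$A_n(p,q)=\sum_{\pi\in\mathfrak S_n}p^{\mathrm{odes}(\pi)}q^{\mathrm{edes}(\pi)}$$ be the refined Eulerian polynomial, and let the Euler number $E_n$ be the number of alternating permutations in $\mathfrak S_n$, i.e. those with $a_1>a_2<a_3>a_4<\cdots$. Then for every integer $n\ge 0$ and every element $p$ of a field of characteristic different from $2$ (for instance $p\in\mathbb C$, or $p$ an indeterminate over $\mathbb Q$), $$A_{2n+1}(p,-1)=\Big(\frac{p-1}{2}\Big)^{n}E_{2n+1},\qquad A_{2n+2}(p,-1)=\frac{p+1}{2}\Big(\frac{p-1}{2}\Big)^{n}E_{2n+3}.$$ -/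

import Mathlib

namespace RefinedEulerian

/-- The descent set of a permutation `π = a₁ a₂ ⋯ aₙ`: all positions `i` with `1 ≤ i ≤ n - 1`
and `aᵢ > aᵢ₊₁`.  Positions are counted from `1`; the word of `π : Equiv.Perm (Fin n)` has the
letter `π ⟨i - 1, _⟩` at position `i`. -/
def descents {n : ℕ} (π : Equiv.Perm (Fin n)) : Finset ℕ :=
  {i ∈ Finset.Ico 1 n | ∃ h : i < n, π ⟨i, h⟩ < π ⟨i - 1, (Nat.sub_le i 1).trans_lt h⟩}

/-- The number of descents in odd positions. -/
def odes {n : ℕ} (π : Equiv.Perm (Fin n)) : ℕ := {i ∈ descents π | Odd i}.card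

/-- The number of descents in even positions. -/
def edes {n : ℕ} (π : Equiv.Perm (Fin n)) : ℕ := {i ∈ descents π | Even i}.card

/-- The value `A_n(p, q)` of the refined Eulerian polynomial, for `p`, `q` in any commutative ring
(indeterminates of a polynomial ring included). -/
def refinedEulerian {R : Type*} [CommRing R] (n : ℕ) (p q : R) : R :=
  ∑ π : Equiv.Perm (Fin n), p ^ odes π * q ^ edes π

/-- `π = a₁ a₂ ⋯ aₙ` is alternating if `a₁ > a₂ < a₃ > a₄ < ⋯`. -/
def IsAlternating {n : ℕ} (π : Equiv.Perm (Fin n)) : Prop :=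
  ∀ (i : ℕ) (h : i < n), 1 ≤ i →
    (Odd i → π ⟨i, h⟩ < π ⟨i - 1, (Nat.sub_le i 1).trans_lt h⟩) ∧
    (Even i → π ⟨i - 1, (Nat.sub_le i 1).trans_lt h⟩ < π ⟨i, h⟩)

/-- The Euler number `E_n`: the number of alternating permutations of `n` letters. -/
noncomputable def eulerNumber (n : ℕ) : ℕ :=
  Nat.card {π : Equiv.Perm (Fin n) // IsAlternating π}

end RefinedEulerian

/-! Weigh a word by the product of its ascent and descent factors, which depend on position. Cutting
at the least letter forces a descent into it and an ascent out of it, so the weight factors and the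
total over all words satisfies a binomial convolution. Both `refinedEulerian` and `eulerNumber` are
instances of `wordSum`.

Put q = -1 and c = (p-1)/2, and write X_n, Y_n for the sums over n-letter words starting at an odd,
resp. even, position; period 2 of the weights makes the two recurrences a closed system. It is
solved by simultaneous induction in `signedSum_eq`. The key point is Y_{2n} = 0 for n > 0: it kills
most of each convolution, and what survives is the tangent-number recurrence for E_{2n+1}
(`eulerNumber_odd_recurrence`), possibly in its halved form (`two_mul_sum_choose_even`). -/

namespace RefinedEulerian

open Finset

/-! ### Position-weighted words and the recurrence at the least letter -/

section Words

variable {R : Type*} [CommRing R] {α : Type*} [LinearOrder α]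

/-- The weight of a word whose first letter sits at position `i`: a factor `a j` for each ascent
and `b j` for each descent at position `j`. -/
def wordWeight (a b : ℕ → R) : ℕ → List α → R
  | _, [] => 1
  | _, [_] => 1
  | i, x :: y :: t => (if y < x then b i else a i) * wordWeight a b (i + 1) (y :: t)

/-- The words that use each letter of `s` exactly once. -/
def words (s : Finset α) : Finset (List α) := s.val.lists.toFinset

/-- The total weight of all words that use each letter of `s` exactly once. -/
def weightSum (a b : ℕ → R) (i : ℕ) (s : Finset α) : R :=
  ∑ l ∈ words s, wordWeight a b i l

variable {a b : ℕ → R}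

lemma wordWeight_cons_of_forall_lt {m : α} {l : List α} (hl : ∀ x ∈ l, m < x) (i : ℕ) :
    wordWeight a b i (m :: l) =
      (if l.length = 0 then 1 else a i) * wordWeight a b (i + 1) l := by
  cases l with
  | nil => simp [wordWeight]
  | cons x t => simp [wordWeight, (hl x (by simp)).le]

/-- The step into `m` is a descent at position `i + l₁.length - 1` and the step out an ascent at `i
+ l₁.length`; an empty block has no such step, hence the factor 1. -/
lemma wordWeight_append_cons {m : α} {l₁ l₂ : List α} (h₁ : ∀ x ∈ l₁, m < x)
    (h₂ : ∀ x ∈ l₂, m < x) (i : ℕ) :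
    wordWeight a b i (l₁ ++ m :: l₂) =
      wordWeight a b i l₁ * (if l₁.length = 0 then 1 else b (i + l₁.length - 1)) *
        ((if l₂.length = 0 then 1 else a (i + l₁.length)) *
          wordWeight a b (i + l₁.length + 1) l₂) := by
  induction l₁ generalizing i with
  | nil => simp [wordWeight, wordWeight_cons_of_forall_lt h₂]
  | cons x t ih =>
    cases t with
    | nil => simp [wordWeight, h₁ x (by simp), wordWeight_cons_of_forall_lt h₂]
    | cons y t =>
      have := ih (fun z hz => h₁ z (List.mem_cons_of_mem _ hz)) (i + 1)
      simp only [List.cons_append, wordWeight] at this ⊢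
      rw [this]
      simp only [List.length_cons, Nat.add_eq_zero_iff, one_ne_zero, and_false, if_false]
      rw [show i + 1 + (t.length + 1) = i + (t.length + 1 + 1) by ring]
      ring

lemma wordWeight_add_two (ha : ∀ i, a (i + 2) = a i) (hb : ∀ i, b (i + 2) = b i) (i : ℕ)
    (l : List α) : wordWeight a b (i + 2) l = wordWeight a b i l := by
  induction l generalizing i with
  | nil => simp [wordWeight]
  | cons x t ih =>
    cases t with
    | nil => simp [wordWeight]
    | cons y t => simp only [wordWeight, ha, hb, show i + 2 + 1 = i + 1 + 2 by ring, ih]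

lemma wordWeight_ofFn (i n : ℕ) (f : Fin (n + 1) → α) :
    wordWeight a b i (List.ofFn f) =
      ∏ j : Fin n, if f j.succ < f j.castSucc then b (i + j) else a (i + j) := by
  induction n generalizing i with
  | zero => simp [List.ofFn_succ, wordWeight]
  | succ n ih =>
    have := ih (i + 1) (fun j => f j.succ)
    rw [List.ofFn_succ] at this
    rw [List.ofFn_succ, List.ofFn_succ, wordWeight, this, Fin.prod_univ_succ]
    simp only [add_assoc, add_comm 1, Fin.succ_zero_eq_one, Fin.val_zero, add_zero,
      Fin.val_succ, Fin.castSucc_zero, Fin.castSucc_succ]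
    rfl

lemma mem_words {s : Finset α} {l : List α} : l ∈ words s ↔ l.Nodup ∧ l.toFinset = s := by
  rw [words, Multiset.mem_toFinset, Multiset.mem_lists_iff]
  constructor
  · intro h
    have hn : l.Nodup := by
      rw [← Multiset.coe_nodup, ← Multiset.quot_mk_to_coe, ← h]
      exact s.nodup
    refine ⟨hn, Finset.val_injective ?_⟩
    rw [List.toFinset_val, hn.dedup, h, Multiset.quot_mk_to_coe]
  · rintro ⟨h, rfl⟩
    rw [List.toFinset_val, h.dedup, Multiset.quot_mk_to_coe]

lemma length_of_mem_words {s : Finset α} {l : List α} (h : l ∈ words s) : l.length = #s := by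
  rw [mem_words] at h
  rw [← h.2, List.toFinset_card_of_nodup h.1]

lemma mem_of_mem_words {s : Finset α} {l : List α} (h : l ∈ words s) (x : α) :
    x ∈ l ↔ x ∈ s := by
  rw [← (mem_words.1 h).2, List.mem_toFinset]

/-- Words with a least letter `m` are split at `m`. -/
lemma weightSum_insert {m : α} {s : Finset α} (hm : ∀ x ∈ s, m < x) (i : ℕ) :
    weightSum a b i (insert m s) = ∑ t ∈ s.powerset,
      weightSum a b i t * (if #t = 0 then 1 else b (i + #t - 1)) *
        ((if #s - #t = 0 then 1 else a (i + #t)) * weightSum a b (i + #t + 1) (s \ t)) := by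
  have hms : m ∉ s := fun h => lt_irrefl _ (hm m h)
  have key : ∀ t ∈ s.powerset,
      weightSum a b i t * (if #t = 0 then 1 else b (i + #t - 1)) *
        ((if #s - #t = 0 then 1 else a (i + #t)) * weightSum a b (i + #t + 1) (s \ t)) =
      ∑ l ∈ words t ×ˢ words (s \ t), wordWeight a b i (l.1 ++ m :: l.2) := by
    intro t ht
    rw [mem_powerset] at ht
    rw [weightSum, weightSum, sum_mul, mul_sum, sum_mul_sum, sum_product]
    refine sum_congr rfl fun l₁ h₁ => sum_congr rfl fun l₂ h₂ => ?_
    dsimp only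
    rw [wordWeight_append_cons
      (fun x hx => hm x (ht ((mem_of_mem_words h₁ x).1 hx)))
      (fun x hx => hm x (sdiff_subset ((mem_of_mem_words h₂ x).1 hx))),
      length_of_mem_words h₁, length_of_mem_words h₂, card_sdiff_of_subset ht]
  rw [sum_congr rfl key, sum_sigma', weightSum]
  symm
  refine sum_bij (fun c _ => c.2.1 ++ m :: c.2.2) ?_ ?_ ?_ (fun _ _ => rfl)
  · rintro ⟨t, l₁, l₂⟩ h
    simp only [mem_sigma, mem_powerset, mem_product, mem_words] at h ⊢
    obtain ⟨ht, ⟨n₁, rfl⟩, n₂, h₂⟩ := h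
    have hs : ∀ x, x ∈ l₂ ↔ x ∈ s ∧ x ∉ l₁ := fun x => by
      rw [← List.mem_toFinset, h₂, mem_sdiff, List.mem_toFinset]
    have ht' : ∀ x ∈ l₁, x ∈ s := fun x hx => ht (List.mem_toFinset.2 hx)
    constructor
    · rw [List.nodup_append, List.nodup_cons]
      refine ⟨n₁, ⟨fun h => hms ((hs m).1 h).1, n₂⟩, ?_⟩
      rintro x hx y hy rfl
      rcases List.mem_cons.1 hy with rfl | hy
      · exact hms (ht' _ hx)
      · exact ((hs x).1 hy).2 hx
    · ext x
      simp only [List.mem_toFinset, List.mem_append, List.mem_cons, hs, mem_insert]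
      have := ht' x
      tauto
  · rintro ⟨t, l₁, l₂⟩ h ⟨t', l₁', l₂'⟩ h' heq
    simp only [mem_sigma, mem_powerset, mem_product] at h h' heq
    have hn : m ∉ l₁ := fun hx => hms (h.1 ((mem_of_mem_words h.2.1 m).1 hx))
    have hn₂ : m ∉ l₂ := fun hx =>
      hms (sdiff_subset ((mem_of_mem_words h.2.2 m).1 hx))
    -- The letter `m` occurs only once, so the cut is determined by the word.
    obtain ⟨rfl, -, rfl⟩ := (List.append_cons_inj_of_notMem hn hn₂).1 heq
    obtain rfl : t = t' := by
      rw [← (mem_words.1 h.2.1).2, ← (mem_words.1 h'.2.1).2]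
    rfl
  · intro l hl
    have hml : m ∈ l := (mem_of_mem_words hl m).2 (mem_insert_self _ _)
    obtain ⟨l₁, l₂, rfl⟩ := List.append_of_mem hml
    obtain ⟨hnd, hs⟩ := mem_words.1 hl
    rw [List.nodup_append, List.nodup_cons] at hnd
    obtain ⟨n₁, ⟨hm₂, n₂⟩, hd⟩ := hnd
    have hd₁ : ∀ x ∈ l₁, x ≠ m ∧ x ∉ l₂ := fun x hx =>
      ⟨hd x hx m (by simp), fun h => hd x hx x (by simp [h]) rfl⟩
    have hs' : ∀ x, x ∈ s ↔ x ∈ l₁ ∨ x ∈ l₂ := fun x => by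
      have h := mem_of_mem_words hl x
      simp only [List.mem_append, List.mem_cons, mem_insert] at h
      by_cases hx : x = m
      · subst hx
        have : x ∉ l₁ := fun h => (hd₁ x h).1 rfl
        tauto
      · tauto
    refine ⟨⟨l₁.toFinset, l₁, l₂⟩, ?_, rfl⟩
    simp only [mem_sigma, mem_powerset, mem_product, mem_words]
    refine ⟨fun x hx => (hs' x).2 (Or.inl (List.mem_toFinset.1 hx)), ⟨n₁, trivial⟩, n₂, ?_⟩
    ext x
    have := hd₁ x
    simp only [List.mem_toFinset, mem_sdiff, hs']
    tauto

lemma weightSum_empty (i : ℕ) : weightSum a b i (∅ : Finset α) = 1 := by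
  have : words (∅ : Finset α) = {[]} := by
    ext l
    simp only [mem_words, List.toFinset_eq_empty_iff, mem_singleton]
    exact ⟨fun h => h.2, fun h => by simp [h]⟩
  simp [weightSum, this, wordWeight]

/-- The total weight of all words with `n` given letters, the first of which sits at position `i`,
computed by splitting at the least letter. -/
def wordSum (a b : ℕ → R) : ℕ → ℕ → R
  | _, 0 => 1
  | i, n + 1 => ∑ k : Fin (n + 1), (n.choose k : R) *
      (wordSum a b i k * (if (k : ℕ) = 0 then 1 else b (i + k - 1)) *
        ((if n - k = 0 then 1 else a (i + k)) * wordSum a b (i + k + 1) (n - k)))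
  termination_by _ n => n
  decreasing_by all_goals omega

lemma wordSum_zero (i : ℕ) : wordSum a b i 0 = 1 := by
  rw [wordSum]

lemma wordSum_succ (i n : ℕ) : wordSum a b i (n + 1) =
    ∑ k ∈ range (n + 1), (n.choose k : R) *
      (wordSum a b i k * (if k = 0 then 1 else b (i + k - 1)) *
        ((if n - k = 0 then 1 else a (i + k)) * wordSum a b (i + k + 1) (n - k))) := by
  rw [wordSum, sum_range]

/-- Only the relative order of letters matters: the left block enters through its size alone, and
the binomial coefficient counts its choices. The start `i` is generalized because the right block
starts further along. -/
lemma weightSum_eq_wordSum (i : ℕ) (s : Finset α) : weightSum a b i s = wordSum a b i #s := by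
  induction h : #s using Nat.strong_induction_on generalizing i s with
  | _ n ih =>
  obtain _ | n := n
  · rw [card_eq_zero.1 h, weightSum_empty, wordSum_zero]
  have hne : s.Nonempty := card_pos.1 (by omega)
  have hc : #(s.erase (s.min' hne)) = n := by
    rw [card_erase_of_mem (s.min'_mem hne), h, Nat.add_sub_cancel]
  conv_lhs => rw [← insert_erase (s.min'_mem hne)]
  rw [weightSum_insert (fun x hx => s.min'_lt_of_mem_erase_min' hne hx)]
  have := sum_powerset_apply_card (x := s.erase (s.min' hne)) (fun k =>
    wordSum a b i k * (if k = 0 then 1 else b (i + k - 1)) *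
    ((if n - k = 0 then 1 else a (i + k)) * wordSum a b (i + k + 1) (n - k)))
  simp only [hc, nsmul_eq_mul] at this
  rw [wordSum_succ, ← this]
  refine sum_congr rfl fun t ht => ?_
  rw [mem_powerset] at ht
  have h₁ := card_le_card ht
  have h₂ := card_sdiff_of_subset ht
  rw [hc] at h₁ h₂
  rw [ih _ (by omega) _ t rfl, ih _ (by omega) _ _ h₂, hc]

lemma wordSum_add_two (ha : ∀ i, a (i + 2) = a i) (hb : ∀ i, b (i + 2) = b i) (i n : ℕ) :
    wordSum a b (i + 2) n = wordSum a b i n := by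
  rw [← card_range n, ← weightSum_eq_wordSum, ← weightSum_eq_wordSum]
  exact sum_congr rfl fun l _ => wordWeight_add_two ha hb i l

lemma wordSum_add_two_mul (ha : ∀ i, a (i + 2) = a i) (hb : ∀ i, b (i + 2) = b i) (i j n : ℕ) :
    wordSum a b (i + 2 * j) n = wordSum a b i n := by
  induction j with
  | zero => rfl
  | succ j ih => rw [← ih, ← wordSum_add_two ha hb (i + 2 * j), mul_add, mul_one, add_assoc]

lemma sum_perm_eq_wordSum (i n : ℕ) :
    ∑ π : Equiv.Perm (Fin (n + 1)),
      ∏ j : Fin n, (if π j.succ < π j.castSucc then b (i + j) else a (i + j)) =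
    wordSum a b i (n + 1) := by
  have h := weightSum_eq_wordSum (a := a) (b := b) i (univ : Finset (Fin (n + 1)))
  rw [card_univ, Fintype.card_fin] at h
  rw [← h, weightSum]
  refine sum_bij (fun π _ => List.ofFn π) ?_ ?_ ?_ ?_
  · intro π _
    rw [mem_words, List.nodup_ofFn]
    refine ⟨π.injective, ?_⟩
    ext x
    rw [List.mem_toFinset, List.mem_ofFn]
    simpa using π.surjective x
  · intro π _ σ _ h
    exact DFunLike.coe_injective (List.ofFn_injective h)
  · intro l hl
    have hlen : l.length = n + 1 := by
      rw [length_of_mem_words hl, card_univ, Fintype.card_fin]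
    obtain ⟨f, rfl⟩ : ∃ f : Fin (n + 1) → Fin (n + 1), List.ofFn f = l := by
      have : ∀ m, l.length = m → ∃ f : Fin m → Fin (n + 1), List.ofFn f = l := by
        rintro _ rfl
        exact ⟨l.get, List.ofFn_get l⟩
      exact this _ hlen
    have hf : Function.Injective f := List.nodup_ofFn.1 (mem_words.1 hl).1
    exact ⟨Equiv.ofBijective f (Finite.injective_iff_bijective.1 hf), mem_univ _, rfl⟩
  · intro π _
    rw [wordWeight_ofFn]

end Words

/-! ### Refined Eulerian polynomials and Euler numbers as word sums -/

section Specialization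

variable {R : Type*} [CommRing R]

lemma pow_odes_mul_pow_edes {n : ℕ} (p q : R) (π : Equiv.Perm (Fin (n + 1))) :
    p ^ odes π * q ^ edes π = ∏ j : Fin n,
      (if π j.succ < π j.castSucc then (if Odd (1 + (j : ℕ)) then p else q) else 1) := by
  have h : p ^ odes π * q ^ edes π = ∏ i ∈ descents π, if Odd i then p else q := by
    rw [prod_ite, prod_const, prod_const, odes, edes]
    simp only [Nat.not_odd_iff_even]
  rw [h, descents, prod_filter, prod_Ico_eq_prod_range, Nat.add_sub_cancel, prod_range]
  refine prod_congr rfl fun j _ => ?_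
  have : (∃ h : 1 + (j : ℕ) < n + 1,
      π ⟨1 + j, h⟩ < π ⟨1 + j - 1, (Nat.sub_le _ 1).trans_lt h⟩) ↔
      π j.succ < π j.castSucc := by
    have h₁ : 1 + (j : ℕ) < n + 1 := by omega
    have h₂ : (⟨1 + j, h₁⟩ : Fin (n + 1)) = j.succ := Fin.ext (by simp [add_comm])
    have h₃ : (⟨1 + j - 1, (Nat.sub_le _ 1).trans_lt h₁⟩ : Fin (n + 1)) = j.castSucc :=
      Fin.ext (by simp)
    rw [exists_prop_of_true h₁, h₂, h₃]
  simp only [this]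

lemma refinedEulerian_succ_eq_wordSum (p q : R) (n : ℕ) :
    refinedEulerian (n + 1) p q =
      wordSum (fun _ => 1) (fun i => if Odd i then p else q) 1 (n + 1) := by
  rw [refinedEulerian, ← sum_perm_eq_wordSum]
  exact sum_congr rfl fun π _ => pow_odes_mul_pow_edes p q π

lemma isAlternating_iff {n : ℕ} (π : Equiv.Perm (Fin (n + 1))) :
    IsAlternating π ↔ ∀ j : Fin n, (π j.succ < π j.castSucc ↔ Odd (1 + (j : ℕ))) := by
  have key : ∀ j : Fin n, (π j.succ < π j.castSucc ↔ Odd (1 + (j : ℕ))) ↔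
      ((Odd (1 + (j : ℕ)) → π j.succ < π j.castSucc) ∧
        (Even (1 + (j : ℕ)) → π j.castSucc < π j.succ)) := by
    intro j
    have hne : π j.castSucc ≠ π j.succ := fun h => j.castSucc_lt_succ.ne (π.injective h)
    rw [← Nat.not_odd_iff_even]
    by_cases ho : Odd (1 + (j : ℕ))
    · simp [ho]
    · simp only [ho, iff_false, not_lt, false_imp_iff, true_and, not_false_eq_true, true_imp_iff]
      exact hne.le_iff_lt
  simp only [key]
  constructor
  · intro h j
    have := h (j + 1) (by omega) (by omega)
    rw [add_comm]
    exact this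
  · rintro h (_ | i) hi h1
    · omega
    · have := h ⟨i, by omega⟩
      rw [add_comm 1] at this
      exact this

/-- With these 0/1 weights the product over positions is the indicator of being alternating. -/
lemma eulerNumber_succ_eq_wordSum (n : ℕ) :
    (eulerNumber (n + 1) : R) =
      wordSum (fun i => if Odd i then 0 else 1) (fun i => if Odd i then 1 else 0) 1 (n + 1) := by
  classical
  rw [← sum_perm_eq_wordSum, eulerNumber, Nat.card_eq_fintype_card, Fintype.card_subtype,
    ← sum_boole]
  refine sum_congr rfl fun π _ => ?_
  rw [isAlternating_iff]
  have := prod_boole (s := (univ : Finset (Fin n))) (M₀ := R)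
    (p := fun j : Fin n => π j.succ < π j.castSucc ↔ Odd (1 + (j : ℕ)))
  simp only [mem_univ, true_imp_iff] at this
  refine Eq.trans (by congr) (this.symm.trans ?_)
  refine prod_congr rfl fun j _ => ?_
  by_cases h : π j.succ < π j.castSucc <;> by_cases ho : Odd (1 + (j : ℕ)) <;> simp [h, ho]

lemma sum_range_two_mul (f : ℕ → R) (n : ℕ) :
    ∑ k ∈ range (2 * n), f k = ∑ j ∈ range n, (f (2 * j) + f (2 * j + 1)) := by
  induction n with
  | zero => simp
  | succ n ih => rw [mul_add, mul_one, sum_range_succ, sum_range_succ, ih, sum_range_succ,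
      add_assoc]

/-- Splitting an alternating permutation of odd length at its least letter. -/
lemma eulerNumber_odd_recurrence (n : ℕ) :
    (eulerNumber (2 * (n + 1) + 1) : R) = ∑ j ∈ range (n + 1),
      ((2 * n + 2).choose (2 * j + 1) : R) *
        (eulerNumber (2 * j + 1) * eulerNumber (2 * (n - j) + 1)) := by
  have hper : ∀ i : ℕ, Odd (i + 2) ↔ Odd i := fun i => by simp [Nat.odd_add]
  have hodd : ∀ j : ℕ, Odd (2 * j + 1) := fun j => odd_two_mul_add_one j
  have hnot : ∀ j : ℕ, ¬ Odd (2 * j) := fun j => by simp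
  have hnot' : ∀ j : ℕ, ¬ Odd (1 + (2 * j + 1)) := fun j => by
    rw [show 1 + (2 * j + 1) = 2 * (j + 1) by ring]; exact hnot _
  have hodd' : ∀ j : ℕ, Odd (1 + 2 * j) := fun j => by rw [add_comm]; exact hodd j
  simp only [eulerNumber_succ_eq_wordSum]
  -- Even `k` puts the minimum at an odd position, where an alternating word of odd length has no
  -- valley; only odd `k` survive.
  rw [wordSum_succ, sum_range_succ, sum_range_two_mul]
  have hlast : ¬ 2 * (n + 1) = 0 := by omega
  simp only [Nat.add_sub_cancel_left, hnot, if_neg hlast, if_false, mul_zero, zero_mul, add_zero]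
  refine sum_congr rfl fun j hj => ?_
  rw [mem_range] at hj
  have h₁ : ¬ 2 * (n + 1) - 2 * j = 0 := by omega
  have h₂ : 2 * (n + 1) - (2 * j + 1) = 2 * (n - j) + 1 := by omega
  rw [if_neg h₁, if_pos (hodd' j), h₂, if_neg (Nat.succ_ne_zero _), if_pos (hodd j),
    if_neg (Nat.succ_ne_zero _), if_neg (hnot' j),
    show 1 + (2 * j + 1) + 1 = 1 + 2 * (j + 1) by ring,
    wordSum_add_two_mul (by simp [hper]) (by simp [hper])]
  ring_nf

lemma eulerNumber_one : eulerNumber 1 = 1 := by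
  have := eulerNumber_succ_eq_wordSum (R := ℤ) 0
  simp [wordSum] at this
  exact_mod_cast this

end Specialization

/-! ### The coupled recurrences at q = -1 and their solution -/

section SignedDescents

variable {R : Type*} [CommRing R]

/-- The refined Eulerian sums at `q = -1` over words whose first letter sits at position `i`. -/
def signedSum (p : R) (i n : ℕ) : R :=
  wordSum (fun _ => 1) (fun i => if Odd i then p else -1) i n

lemma signedSum_add_two_mul (p : R) (i j n : ℕ) :
    signedSum p (i + 2 * j) n = signedSum p i n :=
  wordSum_add_two_mul (fun _ => rfl) (fun i => by simp [Nat.odd_add]) i j n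

lemma signedSum_zero (p : R) (i : ℕ) : signedSum p i 0 = 1 := wordSum_zero i

lemma signedSum_succ (p : R) (i m : ℕ) : signedSum p i (m + 1) =
    ∑ k ∈ range (m + 1), (m.choose k : R) *
      ((if k = 0 then 1 else if Odd (i + k - 1) then p else -1) *
      signedSum p i k * signedSum p (i + k + 1) (m - k)) := by
  rw [signedSum, wordSum_succ]
  refine sum_congr rfl fun k _ => ?_
  simp only [ite_self, one_mul, signedSum]
  ring

/-- The recurrence with the even and the odd positions of the least letter separated. -/
lemma signedSum_one_succ (p : R) (m : ℕ) : signedSum p 1 (m + 1) =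
    ∑ k ∈ range (m + 1), (m.choose k : R) * ((if k = 0 then 1 else if Odd k then p else -1) *
      signedSum p 1 k * signedSum p (if Odd k then 1 else 2) (m - k)) := by
  rw [signedSum_succ]
  refine sum_congr rfl fun k _ => ?_
  have h : signedSum p (1 + k + 1) (m - k) = signedSum p (if Odd k then 1 else 2) (m - k) := by
    rcases Nat.even_or_odd' k with ⟨j, rfl | rfl⟩
    · rw [if_neg (by simp), show 1 + 2 * j + 1 = 2 + 2 * j by ring, signedSum_add_two_mul]
    · rw [if_pos (odd_two_mul_add_one j), show 1 + (2 * j + 1) + 1 = 1 + 2 * (j + 1) by ring,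
        signedSum_add_two_mul]
  rw [h, Nat.add_sub_cancel_left]

lemma signedSum_two_succ (p : R) (m : ℕ) : signedSum p 2 (m + 1) =
    ∑ k ∈ range (m + 1), (m.choose k : R) * ((if k = 0 then 1 else if Odd k then -1 else p) *
      signedSum p 2 k * signedSum p (if Odd k then 2 else 1) (m - k)) := by
  rw [signedSum_succ]
  refine sum_congr rfl fun k _ => ?_
  have h : signedSum p (2 + k + 1) (m - k) = signedSum p (if Odd k then 2 else 1) (m - k) := by
    rcases Nat.even_or_odd' k with ⟨j, rfl | rfl⟩
    · rw [if_neg (by simp), show 2 + 2 * j + 1 = 1 + 2 * (j + 1) by ring, signedSum_add_two_mul]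
    · rw [if_pos (odd_two_mul_add_one j), show 2 + (2 * j + 1) + 1 = 2 + 2 * (j + 1) by ring,
        signedSum_add_two_mul]
  have h' : Odd (2 + k - 1) ↔ ¬ Odd k := by
    rw [show 2 + k - 1 = k + 1 by omega, Nat.odd_add_one]
  simp only [h, h', ite_not]

variable {K : Type*} [Field K]

/-- Pascal's rule splits the coefficient in two; the reflection j ↦ n - j identifies the two
resulting sums. -/
lemma two_mul_sum_choose_even (o : ℕ → K) (n : ℕ) :
    ∑ j ∈ range (n + 1), ((2 * n + 2).choose (2 * j + 1) : K) * (o j * o (n - j)) =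
      2 * ∑ j ∈ range (n + 1), ((2 * n + 1).choose (2 * j) : K) * (o j * o (n - j)) := by
  have hr : ∑ j ∈ range (n + 1), ((2 * n + 1).choose (2 * j + 1) : K) * (o j * o (n - j)) =
      ∑ j ∈ range (n + 1), ((2 * n + 1).choose (2 * j) : K) * (o j * o (n - j)) := by
    rw [← sum_range_reflect]
    refine sum_congr rfl fun j hj => ?_
    rw [mem_range] at hj
    rw [show n + 1 - 1 - j = n - j by omega, show n - (n - j) = j by omega,
      ← Nat.choose_symm_of_eq_add (show 2 * n + 1 = 2 * (n - j) + 1 + 2 * j by omega)]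
    ring
  rw [two_mul (∑ j ∈ _, _)]
  nth_rw 2 [← hr]
  rw [← sum_add_distrib]
  refine sum_congr rfl fun j _ => ?_
  rw [Nat.choose_succ_succ' (2 * n + 1) (2 * j)]
  push_cast
  ring

/-- The values of the refined Eulerian sums at `q = -1`, for words whose first letter sits at
an odd or at an even position. -/
theorem signedSum_eq (h2 : (2 : K) ≠ 0) (p : K) (n : ℕ) :
    signedSum p 1 (2 * n + 1) = ((p - 1) / 2) ^ n * eulerNumber (2 * n + 1) ∧
    signedSum p 2 (2 * n + 1) = ((p - 1) / 2) ^ n * eulerNumber (2 * n + 1) ∧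
    signedSum p 1 (2 * n + 2) =
      (p + 1) / 2 * ((p - 1) / 2) ^ n * eulerNumber (2 * (n + 1) + 1) ∧
    signedSum p 2 (2 * n + 2) = 0 := by
  induction n using Nat.strong_induction_on with
  | _ n ih =>
  set c : K := (p - 1) / 2 with hc
  have hp : p = 2 * c + 1 := by rw [hc]; field_simp; ring
  have hp' : (p + 1) / 2 = c + 1 := by rw [hc]; field_simp; ring
  set o : ℕ → K := fun j => (eulerNumber (2 * j + 1) : K) with ho
  have hrec : ∀ n, o (n + 1) = _ := fun n => eulerNumber_odd_recurrence n
  have hnot : ∀ j : ℕ, ¬ Odd (2 * j) := fun j => by simp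
  have hodd : ∀ j : ℕ, Odd (2 * j + 1) := fun j => odd_two_mul_add_one j
  have ho0 : o 0 = 1 := by simp [ho, eulerNumber_one]
  have heven : ∀ j, 0 < j → j ≤ n → signedSum p 2 (2 * j) = 0 := by
    rintro (_ | j) h hj
    · omega
    · exact (ih j (by omega)).2.2.2
  have heven' : ∀ j, j < n → signedSum p 1 (2 * j + 2) = (c + 1) * c ^ j * o (j + 1) :=
    fun j hj => by rw [(ih j hj).2.2.1, hp']
  have hpow : ∀ j m, j ≤ m → c ^ j * c ^ (m - j) = c ^ m := fun j m h => by
    rw [← pow_add, Nat.add_sub_cancel' h]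
  have hx : signedSum p 1 (2 * n + 1) = c ^ n * o n := by
    rcases n with _ | n
    · simp [signedSum, wordSum, ho0]
    have hsum : ∑ j ∈ range (n + 1), (((2 * n + 2).choose (2 * j) : K) *
          ((if 2 * j = 0 then 1 else -1) * signedSum p 1 (2 * j) *
            signedSum p 2 (2 * n + 2 - 2 * j)) +
        ((2 * n + 2).choose (2 * j + 1) : K) * (p * signedSum p 1 (2 * j + 1) *
            signedSum p 1 (2 * n + 2 - (2 * j + 1)))) = p * c ^ n * o (n + 1) := by
      rw [hrec, mul_sum]
      refine sum_congr rfl fun j hj => ?_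
      rw [mem_range] at hj
      rw [show 2 * n + 2 - 2 * j = 2 * (n + 1 - j) by omega, heven _ (by omega) (by omega),
        show 2 * n + 2 - (2 * j + 1) = 2 * (n - j) + 1 by omega, (ih j (by omega)).1,
        (ih (n - j) (by omega)).1, ← hpow j n (by omega)]
      ring
    -- The peeled-off term k = 2n + 2 is -X_{2n+2}, and p - (c + 1) = c.
    rw [signedSum_one_succ, sum_range_succ, sum_range_two_mul]
    simp only [hnot, hodd, if_false, if_true, if_neg (Nat.succ_ne_zero _)]
    have h0 : ¬ 2 * (n + 1) = 0 := by omega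
    rw [if_neg h0, Nat.sub_self, signedSum_zero, Nat.choose_self, mul_add, mul_one, hsum,
      heven' n (by omega), hp]
    push_cast
    ring
  have hy : signedSum p 2 (2 * n + 1) = c ^ n * o n := by
    rcases n with _ | n
    · simp [signedSum, wordSum, ho0]
    have hsum : ∑ j ∈ range (n + 1), (((2 * n + 2).choose (2 * j) : K) *
          ((if 2 * j = 0 then 1 else p) * signedSum p 2 (2 * j) *
            signedSum p 1 (2 * n + 2 - 2 * j)) +
        ((2 * n + 2).choose (2 * j + 1) : K) * (-1 * signedSum p 2 (2 * j + 1) *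
            signedSum p 2 (2 * n + 2 - (2 * j + 1)))) =
        signedSum p 1 (2 * n + 2) - c ^ n * o (n + 1) := by
      rw [sum_add_distrib, sum_eq_single 0, sub_eq_add_neg]
      · congr 1
        · simp [signedSum_zero]
        · rw [hrec, mul_sum, ← sum_neg_distrib]
          refine sum_congr rfl fun j hj => ?_
          rw [mem_range] at hj
          rw [show 2 * n + 2 - (2 * j + 1) = 2 * (n - j) + 1 by omega, (ih j (by omega)).2.1,
            (ih (n - j) (by omega)).2.1, ← hpow j n (by omega)]
          ring
      · intro j hj h0
        rw [mem_range] at hj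
        rw [heven j (by omega) (by omega)]
        ring
      · simp
    rw [signedSum_two_succ, sum_range_succ, sum_range_two_mul]
    simp only [hnot, hodd, if_false, if_true, if_neg (Nat.succ_ne_zero _)]
    rw [heven (n + 1) (by omega) le_rfl, mul_add, mul_one, hsum, heven' n (by omega)]
    ring
  refine ⟨hx, hy, ?_, ?_⟩
  · have hrec' := hrec n
    rw [two_mul_sum_choose_even o n] at hrec'
    rw [hp', signedSum_one_succ, show 2 * n + 1 + 1 = 2 * (n + 1) by ring, sum_range_two_mul,
      sum_add_distrib]
    simp only [hnot, hodd, if_false, if_true, if_neg (Nat.succ_ne_zero _)]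
    -- Reflecting the odd terms pairs both families on X_{2j} and index 2(n-j)+1. The joint factor
    -- is p - 1 = 2c for j > 0 and p + 1 = 2(c + 1) for j = 0.
    rw [← sum_range_reflect (fun j => ((2 * n + 1).choose (2 * j + 1) : K) *
      (p * signedSum p 1 (2 * j + 1) * signedSum p 1 (2 * n + 1 - (2 * j + 1)))),
      ← sum_add_distrib]
    change _ = (c + 1) * c ^ n * o (n + 1)
    rw [hrec', mul_sum, mul_sum]
    refine sum_congr rfl fun j hj => ?_
    rw [mem_range] at hj
    have hyj : signedSum p 2 (2 * (n - j) + 1) = c ^ (n - j) * o (n - j) := by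
      -- For j = 0 the index is n itself, beyond the induction hypothesis.
      rcases j with _ | j
      · exact hy
      · exact (ih _ (by omega)).2.1
    have hxj : signedSum p 1 (2 * (n - j) + 1) = c ^ (n - j) * o (n - j) := by
      rcases j with _ | j
      · exact hx
      · exact (ih _ (by omega)).1
    rw [show n + 1 - 1 - j = n - j by omega, show 2 * n + 1 - (2 * (n - j) + 1) = 2 * j by omega,
      show 2 * n + 1 - 2 * j = 2 * (n - j) + 1 by omega, hyj, hxj,
      Nat.choose_symm_of_eq_add (show 2 * n + 1 = 2 * (n - j) + 1 + 2 * j by omega)]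
    rcases j with _ | j
    · simp only [mul_zero, if_true, signedSum_zero, ho0, Nat.sub_zero, hp]
      ring
    · have h0 : ¬ 2 * (j + 1) = 0 := by omega
      rw [if_neg h0, show 2 * (j + 1) = 2 * j + 2 by ring, heven' j (by omega), hp,
        ← hpow (j + 1) n (by omega)]
      ring
  · rw [signedSum_two_succ, show 2 * n + 1 + 1 = 2 * (n + 1) by ring, sum_range_two_mul,
      sum_add_distrib]
    simp only [hnot, hodd, if_false, if_true, if_neg (Nat.succ_ne_zero _)]
    -- Only k = 0 and k = 2n + 1 survive, giving X_{2n+1} - Y_{2n+1} = 0.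
    rw [sum_eq_single 0, sum_eq_single n]
    · simp only [mul_zero, if_true, signedSum_zero, Nat.sub_zero, Nat.sub_self, hx, hy,
        Nat.choose_self, Nat.choose_zero_right]
      ring
    · intro j hj h0
      rw [mem_range] at hj
      rw [show 2 * n + 1 - (2 * j + 1) = 2 * (n - j) by omega, heven _ (by omega) (by omega)]
      ring
    · simp
    · intro j hj h0
      rw [mem_range] at hj
      rw [heven j (by omega) (by omega)]
      ring
    · simp

end SignedDescents

end RefinedEulerian

theorem corollary3p5 {K : Type*} [Field K] (h2 : (2 : K) ≠ 0) (p : K) (n : ℕ) :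
    RefinedEulerian.refinedEulerian (2 * n + 1) p (-1) =
        ((p - 1) / 2) ^ n * (RefinedEulerian.eulerNumber (2 * n + 1) : K) ∧
      RefinedEulerian.refinedEulerian (2 * n + 2) p (-1) =
        ((p + 1) / 2) * ((p - 1) / 2) ^ n * (RefinedEulerian.eulerNumber (2 * n + 3) : K) := by
  obtain ⟨h₁, -, h₃, -⟩ := RefinedEulerian.signedSum_eq h2 p n
  rw [RefinedEulerian.refinedEulerian_succ_eq_wordSum,
    RefinedEulerian.refinedEulerian_succ_eq_wordSum]
  exact ⟨h₁, h₃⟩
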